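/- For positive integers $k,t$, let $D(k,t)$ be the infinite graph with vertex set $\mathbb{Z}$ in which two distinct integers $i,j$ are adjacent if and only if $|i-j|\in\{k,t\}$. A packing $p$-coloring of a graph $G$ is a partition of its vertex set into disjoint (possibly empty) classes $X_1,\dots,X_p$ such that, for every $i$, any two distinct vertices $u,v\in X_i$ satisfy $\mathrm{dist}_G(u,v)>i$; the packing chromatic number $\chi_\rho(G)$ is the smallest integer $p$ for which $G$ has a packing $p$-coloring. Theorem. Let $k,t$ be positive integers such that $k$ is even, $t\ge 923$ is odd, and $k,t$ are coprime (i.e. $D(k,t)$ is a connected graph). Then $\chi_\rho(D(k,t))\le 56$. -/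

import Mathlib

/-- The (infinite) distance graph with distance set `D`: its vertices are the integers, and two
distinct integers `i`, `j` are adjacent if and only if `|i - j| ∈ D`. -/
def distanceGraph (D : Set ℕ) : SimpleGraph ℤ where
  Adj i j := i ≠ j ∧ (i - j).natAbs ∈ D
  symm := ⟨fun i j h => ⟨h.1.symm, by rw [← Int.natAbs_neg, neg_sub]; exact h.2⟩⟩
  loopless := ⟨fun _ h => h.1 rfl⟩

namespace SimpleGraph

/-- A set `X` of vertices is an `i`-packing if any two distinct vertices of `X` are at distance
greater than `i` in `G` (vertices in different components are at distance `⊤`). -/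
def IsPacking {V : Type*} (G : SimpleGraph V) (i : ℕ) (X : Set V) : Prop :=
  ∀ u ∈ X, ∀ v ∈ X, u ≠ v → (i : ℕ∞) < G.edist u v

/-- A packing `p`-coloring of `G`, given as a map from the vertices to the colors `1, …, p` such
that for every color `i` the color class of `i` (possibly empty) is an `i`-packing. -/
def IsPackingColoring {V : Type*} (G : SimpleGraph V) (p : ℕ) (c : V → ℕ) : Prop :=
  (∀ v, c v ∈ Set.Icc 1 p) ∧ ∀ i ∈ Set.Icc 1 p, G.IsPacking i {v | c v = i}

/-- The packing chromatic number of `G`: the smallest `p` such that `G` has a packing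
`p`-coloring, and `⊤` if there is no such `p`. -/
noncomputable def packingChromaticNumber {V : Type*} (G : SimpleGraph V) : ℕ∞ :=
  ⨅ (p : ℕ) (_ : ∃ c : V → ℕ, G.IsPackingColoring p c), (p : ℕ∞)

end SimpleGraph

/-! Since `k` and `t` are coprime, `(x, y) ↦ k x + t y` identifies `D(k, t)` with the square grid
modulo `(t, -k)`. It thus suffices to color the grid with few colors, respecting `ℓ¹`-distances and
invariantly under `(t, -k)`.

A 21-coloring of the grid with periods `(24, 0)` and `(0, 24)` is cut by vertical seams: strips
using colors up to 47, after which the pattern resumes displaced. Kernel-checked tables give the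
displacements `(61, 4)`, `(58, 2)`, `(62, 2)`. Displacements add (`Shifts.add`), and modulo 24 their
combinations reach every (odd, even) pair within the available width once `t ≥ 923`. Rolling up the
result (`Shifts.exists_periodic`) gives 47 colors, fewer than required. -/

/-! ### Plane colorings and gluing -/

/-- A coloring of the square lattice `ℤ × ℤ` with the colors `1, …, p` in which distinct points of
color `i` are at `ℓ¹`-distance greater than `i`. -/
structure IsPlaneColoring (p : ℕ) (c : ℤ → ℤ → ℕ) : Prop where
  mem_Icc : ∀ x y, c x y ∈ Set.Icc 1 p
  ne_of_le : ∀ x y a b : ℤ, (a ≠ 0 ∨ b ≠ 0) → a.natAbs + b.natAbs ≤ c x y → c (x + a) (y + b) ≠ c x y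

theorem IsPlaneColoring.of_nonneg {p : ℕ} {c : ℤ → ℤ → ℕ} (hc : ∀ x y, c x y ∈ Set.Icc 1 p)
    (h : ∀ x y a b : ℤ, 0 ≤ a → (a ≠ 0 ∨ b ≠ 0) → a.natAbs + b.natAbs ≤ c x y →
      c (x + a) (y + b) ≠ c x y) : IsPlaneColoring p c := by
  refine ⟨hc, fun x y a b hab hle heq => ?_⟩
  rcases le_total 0 a with ha | ha
  · exact h x y a b ha hab hle heq
  · refine h (x + a) (y + b) (-a) (-b) (by omega) (by omega) (by omega) ?_
    rw [heq, add_neg_cancel_right, add_neg_cancel_right]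

theorem IsPlaneColoring.translate {p : ℕ} {c : ℤ → ℤ → ℕ} (hc : IsPlaneColoring p c) (m n : ℤ) :
    IsPlaneColoring p fun x y => c (x - m) (y - n) := by
  refine ⟨fun x y => hc.mem_Icc _ _, fun x y a b hab hle => ?_⟩
  have := hc.ne_of_le (x - m) (y - n) a b hab hle
  rwa [show x - m + a = x + a - m by ring, show y - n + b = y + b - n by ring] at this

/-- Two plane colorings that agree on `p` consecutive columns can be glued along these. -/
theorem IsPlaneColoring.glue {p : ℕ} {f g : ℤ → ℤ → ℕ} (hf : IsPlaneColoring p f)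
    (hg : IsPlaneColoring p g) (m : ℤ) (hfg : ∀ x y, m ≤ x → x < m + p → f x y = g x y) :
    IsPlaneColoring p fun x y => if x < m then f x y else g x y := by
  refine .of_nonneg (fun x y => ?_) fun x y a b ha hab hle => ?_
  · split_ifs
    exacts [hf.mem_Icc x y, hg.mem_Icc x y]
  · by_cases hx : x < m
    · rw [if_pos hx] at hle ⊢
      have hp := (hf.mem_Icc x y).2
      have := hf.ne_of_le x y a b hab hle
      split_ifs with h
      · exact this
      -- Here `a ≤ f x y ≤ p`, so the second point lies in the columns where `f` and `g` agree.
      · rwa [← hfg (x + a) (y + b) (by omega) (by omega)]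
    · rw [if_neg hx] at hle ⊢
      rw [if_neg (by omega)]
      exact hg.ne_of_le x y a b hab hle

/-! ### Displacements and rolling up -/

/-- `Shifts c p a b` says that some plane coloring with `p` colors starts with `p` columns of `c`
and continues, from column `a` on, as the translate of `c` by `(a, b)`. -/
def Shifts (c : ℤ → ℤ → ℕ) (p : ℕ) (a b : ℤ) : Prop :=
  ∃ f : ℤ → ℤ → ℕ, IsPlaneColoring p f ∧ (∀ x y : ℤ, x < p → f x y = c x y) ∧
    ∀ x y : ℤ, a ≤ x → f x y = c (x - a) (y - b)

theorem Shifts.add {c : ℤ → ℤ → ℕ} {p : ℕ} {a b a' b' : ℤ} (h : Shifts c p a b)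
    (h' : Shifts c p a' b') (ha : 0 ≤ a) (ha' : 0 ≤ a') : Shifts c p (a + a') (b + b') := by
  obtain ⟨f, hf, hfl, hfr⟩ := h
  obtain ⟨g, hg, hgl, hgr⟩ := h'
  refine ⟨_, hf.glue (hg.translate a b) a fun x y h1 h2 => ?_, fun x y hx => ?_, fun x y hx => ?_⟩
  · rw [hfr x y h1, hgl _ _ (by omega)]
  · split_ifs with h
    · exact hfl x y hx
    · rw [hgl _ _ (by omega), ← hfr x y (by omega), hfl x y hx]
  · rw [if_neg (by omega), hgr _ _ (by omega)]
    congr 1 <;> ring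

theorem Shifts.nsmul {c : ℤ → ℤ → ℕ} {p : ℕ} {a b : ℤ} (h0 : Shifts c p 0 0)
    (h : Shifts c p a b) (ha : 0 ≤ a) (n : ℕ) : Shifts c p (n * a) (n * b) := by
  induction n with
  | zero => simpa using h0
  | succ n ih =>
    have := ih.add h (by positivity) ha
    convert this using 1 <;> push_cast <;> ring

/-- Rolling up the plane: a coloring that realizes the shift `(t, -k)` induces one that is
invariant under `(t, -k)`. -/
theorem Shifts.exists_periodic {c : ℤ → ℤ → ℕ} {p : ℕ} {t k : ℤ} (h : Shifts c p t (-k))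
    (ht : 0 < t) (hpt : p ≤ t) :
    ∃ f : ℤ → ℤ → ℕ, IsPlaneColoring p f ∧ ∀ x y, f (x + t) (y - k) = f x y := by
  obtain ⟨f, hf, hfl, hfr⟩ := h
  -- The rolled-up coloring is a translate of `f` on windows of width `t + p`, which contain every
  -- pair to be compared. Past column `t` this holds because `f` there repeats its own first `p`
  -- columns.
  have key : ∀ q r y : ℤ, 0 ≤ r → r < t + p →
      f ((r + t * q) % t) (y + k * ((r + t * q) / t)) = f r (y + k * q) := by
    intro q r y hr hrt
    rw [Int.add_mul_emod_self_left, Int.add_mul_ediv_left _ _ ht.ne']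
    by_cases h : r < t
    · rw [Int.emod_eq_of_lt hr h, Int.ediv_eq_zero_of_lt hr h, zero_add]
    · obtain ⟨s, rfl⟩ : ∃ s, r = s + t * 1 := ⟨r - t, by ring⟩
      rw [Int.add_mul_emod_self_left, Int.add_mul_ediv_left _ _ ht.ne',
        Int.emod_eq_of_lt (by omega) (by omega), Int.ediv_eq_zero_of_lt (by omega) (by omega),
        hfl _ _ (by omega), hfr _ _ (by omega)]
      congr 1 <;> ring
  refine ⟨fun x y => f (x % t) (y + k * (x / t)), ?_, fun x y => ?_⟩
  · refine .of_nonneg (fun x y => hf.mem_Icc _ _) fun x y a b ha hab hle => ?_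
    have h0 := Int.emod_nonneg x ht.ne'
    have h1 := Int.emod_lt_of_pos x ht
    have hp := (hf.mem_Icc (x % t) (y + k * (x / t))).2
    have := hf.ne_of_le _ _ a b hab hle
    rw [show y + k * (x / t) + b = y + b + k * (x / t) by ring,
      ← key (x / t) (x % t + a) (y + b) (by omega) (by omega)] at this
    rwa [show x % t + a + t * (x / t) = x + a by linarith [Int.emod_add_mul_ediv x t]] at this
  · dsimp only
    rw [Int.add_emod_right, Int.add_ediv_of_dvd_right dvd_rfl, Int.ediv_self ht.ne']
    congr 1
    ring

/-! ### From the grid to the distance graph -/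

/-- Integers at distance at most `i` in the distance graph `D(k, t)` differ by `k a + t b` with
`|a| + |b| ≤ i`. -/
theorem exists_eq_add_of_walk {k t : ℕ} {m n : ℤ} (w : (distanceGraph {k, t}).Walk m n) :
    ∃ a b : ℤ, n = m + k * a + t * b ∧ a.natAbs + b.natAbs ≤ w.length := by
  induction w with
  | nil => exact ⟨0, 0, by simp, by simp⟩
  | @cons u v w h p ih =>
    obtain ⟨a, b, hab, hle⟩ := ih
    rw [SimpleGraph.Walk.length_cons]
    rcases h.2 with h | h <;> rcases Int.natAbs_eq (u - v) with h' | h' <;> rw [h] at h'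
    · exact ⟨a - 1, b, by rw [hab, sub_eq_iff_eq_add.1 h']; ring, by omega⟩
    · exact ⟨a + 1, b, by rw [hab, sub_eq_iff_eq_add.1 h']; ring, by omega⟩
    · exact ⟨a, b - 1, by rw [hab, sub_eq_iff_eq_add.1 h']; ring, by omega⟩
    · exact ⟨a, b + 1, by rw [hab, sub_eq_iff_eq_add.1 h']; ring, by omega⟩

theorem IsPlaneColoring.isPackingColoring {p k t : ℕ} {f : ℤ → ℤ → ℕ} (hf : IsPlaneColoring p f)
    (hper : ∀ x y, f (x + t) (y - k) = f x y) (ht : 0 < t) (hkt : Nat.Coprime k t) :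
    ∃ c, (distanceGraph {k, t}).IsPackingColoring p c := by
  obtain ⟨u, v, huv⟩ : IsCoprime (k : ℤ) t := Nat.isCoprime_iff_coprime.2 hkt
  have hper' : ∀ (q : ℕ) (x y : ℤ), f (x + t * q) (y - k * q) = f x y := by
    intro q
    induction q with
    | zero => simp
    | succ q ih =>
      intro x y
      rw [← ih x y, ← hper (x + t * q)]
      congr 1 <;> push_cast <;> ring
  -- By coprimality the kernel of `(x, y) ↦ k x + t y` is generated by `(t, -k)`.
  have hker : ∀ x y x' y' : ℤ, k * x + t * y = k * x' + t * y' → f x y = f x' y' := by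
    intro x y x' y' h
    obtain ⟨q, hq⟩ : (t : ℤ) ∣ x - x' := by
      refine (Nat.isCoprime_iff_coprime.2 hkt.symm).dvd_of_dvd_mul_left
        (show (t : ℤ) ∣ k * (x - x') from ⟨y' - y, ?_⟩)
      linarith
    have hq' : y = y' - k * q := by
      have : (t : ℤ) * y = t * (y' - k * q) := by
        linear_combination h - (k : ℤ) * hq
      exact mul_left_cancel₀ (by exact_mod_cast ht.ne') this
    rcases Int.eq_nat_or_neg q with ⟨r, rfl | rfl⟩
    · rw [← hper' r x' y', hq', show x = x' + t * r by linarith]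
    · rw [← hper' r x y, hq']
      congr 1 <;> linarith
  -- By Bézout, `(u n, v n)` is a grid point lying over `n`.
  refine ⟨fun n => f (u * n) (v * n), fun n => hf.mem_Icc _ _, ?_⟩
  rintro i - m (hm : f (u * m) (v * m) = i) n (hn : f (u * n) (v * n) = i) hmn
  by_contra! hle
  obtain ⟨w, hw⟩ := SimpleGraph.exists_walk_of_edist_ne_top (ne_top_of_le_ne_top (by simp) hle)
  rw [← hw] at hle
  obtain ⟨a, b, hab, hlen⟩ := exists_eq_add_of_walk w
  have hi : a.natAbs + b.natAbs ≤ i := hlen.trans (by exact_mod_cast hle)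
  refine hf.ne_of_le (u * m) (v * m) a b ?_ (hm ▸ hi) ?_
  · by_contra! h
    simp [h.1, h.2] at hab
    exact hmn hab.symm
  · rw [hm, ← hn]
    apply hker
    rw [hab]
    linear_combination (-(k : ℤ) * a - t * b) * huv

/-! ### Tables and their kernel verification -/

/-- The base-64 digit of `T` at place `n`. -/
def digit (T n : ℕ) : ℕ := T >>> (6 * n) % 64

/-- A plane coloring with `21` colors and periods `(24, 0)` and `(0, 24)`, as a column-wise table. -/
def tile : ℕ :=
  3968852680629884484218100601316984855309028250018967223162443780278623603803503630260026556887290640649998158466133327041993050919147766364393092815848632902774087885764723784026961369510686536097957023652592639263966488231355012323790158944460999611754301790031009775997254526875973578643618002590969309988422089504821028914004205801009122386888876517154739960896418043483723768414957571646055604119317522575633014761159715833961141418535614951269571559342730068491841583119000156749686514573857173330485463113403897123889107408703558021058482169751884419717721529170597720433615191938670252798443560731062300062487133522966599104636781036799270915998121591964212853160928451706797976598813741311779829348411560163746149002000844229442021161194563028935899894489938638776938225598023012255363028996384351573265301864552223679855884345341669140611573728903344044470598419887748948086130216386735629736374650487992740041913032755075425953435968934524988208427886384459624027927957654702436603901860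102643937754565228226173667274021531291777

def tileColor (x y : ℤ) : ℕ := digit tile (24 * (x % 24).toNat + (y % 24).toNat)

/-- The coloring that is `tileColor` left of column `47`, is given there by `w` columns of period
`48` read from the table `T`, and is the translate of `tileColor` by `(47 + w, b)` thereafter. -/
def seam (T w b : ℕ) (x y : ℤ) : ℕ :=
  if x < 47 then tileColor x y
  else if x < 47 + w then digit T (48 * (x - 47).toNat + (y % 48).toNat)
  else tileColor (x - (47 + w : ℕ)) (y - b)

/-- Bounded universal quantification with good kernel reduction. -/
def allBelow (n : ℕ) (f : ℕ → Bool) : Bool := Nat.rec true (fun i ih => f i && ih) n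

theorem allBelow_eq_true {n : ℕ} {f : ℕ → Bool} : allBelow n f = true ↔ ∀ i < n, f i = true := by
  induction n with
  | zero => simp [allBelow]
  | succ n ih =>
    have : allBelow (n + 1) f = (f n && allBelow n f) := rfl
    rw [this, Bool.and_eq_true, ih, Nat.forall_lt_succ_right, and_comm]

/-- Application of `f` to the evaluated argument `n`. -/
def forceApply {α : Type} (n : ℕ) (f : ℕ → α) : α := Nat.rec (f 0) (fun i _ => f (i + 1)) n

theorem forceApply_eq {α : Type} (n : ℕ) (f : ℕ → α) : forceApply n f = f n := by
  cases n <;> rfl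

/-- No point `(x + a, y + b)` with `0 ≤ a < l` and `a + |b| ≤ c` has color `c` under `g`, except
possibly `(x, y)`. -/
def ballCheck (g : ℕ → ℕ → ℕ) (x y c l : ℕ) : Bool :=
  allBelow l fun a => forceApply (x + a) fun x' => forceApply (y + a - c) fun y' =>
    allBelow (2 * (c - a) + 1) fun e =>
      !(Nat.beq (g x' (y' + e)) c) || (Nat.beq a 0 && Nat.beq e c)

def tileNat (x y : ℕ) : ℕ := digit tile (24 * (x % 24) + y % 24)

def seamNat (T w b x y : ℕ) : ℕ :=
  bif Nat.blt x 47 then tileNat x y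
  else bif Nat.blt x (47 + w) then digit T (48 * (x - 47) + y % 48)
  -- Adding the period 24 avoids truncated subtraction.
  else tileNat (x - (47 + w)) (y + 24 - b)

def tileCheck : Bool :=
  allBelow 24 fun x => allBelow 24 fun y => forceApply (tileNat x y) fun c =>
    Nat.ble 1 c && Nat.ble c 21 && ballCheck tileNat x (y + 48) c (c + 1)

/-- Tile colors are at most 21, so left of column 26 they cannot reach the seam. Colors above 21 do
not occur right of it, so their search stops at its end. Raising `y` by 48 keeps the ball at
nonnegative heights. -/
def seamCheck (T w b : ℕ) : Bool :=
  allBelow (21 + w) fun i => forceApply (i + 26) fun x => allBelow 48 fun y =>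
    forceApply (seamNat T w b x y) fun c =>
      Nat.ble 1 c && Nat.ble c 47 &&
        ballCheck (seamNat T w b) x (y + 48) c (bif Nat.ble c 21 then c + 1 else 47 + w - x)

theorem tileCheck_eq_true : tileCheck = true := by decide +kernel

/-- The table names refer to the parity of the total width `47 + w`. -/
def evenTable : ℕ :=
  7643416154930703241826767257894743162385454509899795909055076972416612110678634586919623482990814718904254376254619207023501122004089810822921916320935694917581068674428466509260831659108086839101782514845721763679881264540674583419608910348621139318923786864553500758745366912476812659329327747136733474974833154894904282284532512457393459484488688084378412886359390992458609162560907136394629123606362587575984896035342089462025765568269009036475337585458673702399518840021153549931377738113635480379346467159566136240186543189185194783245891159704227939598808270028371695136761527497541660468190361488413457673485788470915702016714717886814333832979929258766008555867691955570315410960820443729794058251812889586433720934350749816077656665571633654731309321021169216139470272128486907889266061072423156216587158871045648987839126850565132239569330786979873531345244574619767541217959755500165804042262617606503333064033855403637205710382053384806475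

def evenTable' : ℕ :=
  467565556193539430974598409698705469685230182719550377742716393319325357759974621090040096087737114678159251057673907795467012093015904162580838555019968462261615166823941433172281291964753234739767404750009795671785006332129716610684231549648161747281140596376563775221938738448707568467887307400460034472224705962026055412130544802278407226733535154495953611061656474901743305125868613105819394186264189560048495752866643816296269903296961263235194799848692912335533305148210016524644040069189988836491757650331898019868002845100029552443259753712053519038374011326205903939305253557695726926724516947814480315442123736878879599157580496186114733919948211704327400882536882698571755987437751590831351921393707219402295474814945215309429584372883175755668632800771149860251130796864235537882401336240567242308470754448163210886667158322459285644619810794173608487727956311573649746771728162889998119704781436887626430076259705518961886007391064580424564039569238533535978803726246212510773527267472982307607419625883813494207517767999611241815402452159571855609972891506371607786079537748654299494107394853892722703899377541639005341908218870661586827696816151350897074844124425913495599094865020892756496587250301504183776900264556816780995411655991636501731503287264248302331461445771736400552011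

def oddTable : ℕ :=
  995443669955333218801369048678116344331248482614205339738502463986640864454409754532518657051913160793167707938925198800548507900666527938854851156587960013140824115812203651455655350270791913737262657238566306610409719515896145234750833680517279529956324089484410323631637470130082528937895518562577906611892428626427930478745265151767672266531025448355431662515893554134556899272655727331592647369856748386539225534539890381794091323147576324344992111180043458745726984920430886057610909418748868453975982405391563781424348172808004531840066900598432936928868368314011638912583333321128540155115054931481801330570524901208924763062004036473920730506736130113467835815006204747469994683025562472505576754091809514800579771546684835399054916282047838716682960351443059287784956223774110295095130094339421995140440127616605992536215183846648766506745464058995496067118726787533302844332053362741477186938495687656882757364935911582633996052673284421187665945880154050103039986313878913970496423787072489450928654616421478734051171363541896630136696703294459398018407574701627194505453925898612471720457007771496385657487578272331104340977794189404699250118101611178883605496477287792890850253827808123979806564449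

theorem seamCheck_evenTable : seamCheck evenTable 11 2 = true := by decide +kernel

theorem seamCheck_evenTable' : seamCheck evenTable' 15 2 = true := by decide +kernel

theorem seamCheck_oddTable : seamCheck oddTable 14 4 = true := by decide +kernel

/-! ### From Boolean checks to plane colorings -/

theorem tileColor_eq {x y : ℤ} (hx : 0 ≤ x) (hy : 0 ≤ y) :
    tileColor x y = tileNat x.toNat y.toNat := by
  rw [tileColor, tileNat, Int.toNat_emod hx (by norm_num), Int.toNat_emod hy (by norm_num)]
  rfl

theorem tileColor_add_mul (x y m n : ℤ) : tileColor (x + 24 * m) (y + 24 * n) = tileColor x y := by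
  simp only [tileColor, Int.add_mul_emod_self_left]

theorem tileColor_emod (x y : ℤ) : tileColor (x % 24) (y % 24) = tileColor x y := by
  simp only [tileColor, Int.emod_emod_of_dvd _ dvd_rfl]

theorem seam_eq {T w b : ℕ} (hb : b ≤ 24) {x y : ℤ} (hx : 0 ≤ x) (hy : 0 ≤ y) :
    seam T w b x y = seamNat T w b x.toNat y.toNat := by
  lift x to ℕ using hx
  lift y to ℕ using hy
  simp only [seam, seamNat, Int.toNat_natCast, cond_eq_ite, Nat.blt_eq]
  split_ifs with h1 h2 h3 h4 h5 h6 <;> try omega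
  · exact tileColor_eq (by omega) (by omega)
  · congr 1
    omega
  · rw [← tileColor_add_mul _ _ 0 1, tileColor_eq (by omega) (by omega)]
    congr 1 <;> omega

theorem seam_add_mul {T w b : ℕ} (x y n : ℤ) : seam T w b x (y + 48 * n) = seam T w b x y := by
  have (x y : ℤ) : tileColor x (y + 48 * n) = tileColor x y := by
    rw [← tileColor_add_mul x y 0 (2 * n)]
    congr 1 <;> ring
  simp only [seam, this, Int.add_mul_emod_self_left, add_sub_right_comm]

theorem ne_of_ballCheck {g : ℕ → ℕ → ℕ} {x y c l : ℕ} (h : ballCheck g x y c l = true)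
    (hy : c ≤ y) {a b : ℤ} (ha : 0 ≤ a) (hal : a < l) (hab : a ≠ 0 ∨ b ≠ 0)
    (hle : a.natAbs + b.natAbs ≤ c) : g (x + a).toNat (y + b).toNat ≠ c := by
  simp only [ballCheck, forceApply_eq, allBelow_eq_true] at h
  have := h a.toNat (by omega) (b + (c - a.toNat)).toNat (by omega)
  simp only [Bool.or_eq_true, Bool.not_eq_true', Bool.and_eq_true, Nat.beq_eq] at this
  rcases this with h | h
  · rw [show (x + a).toNat = x + a.toNat by omega, show (y + b).toNat =
      y + a.toNat - c + (b + (c - a.toNat)).toNat by omega]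
    exact Nat.ne_of_beq_eq_false h
  · omega

theorem tileColor_mem_Icc_and_ne (x y : ℤ) : tileColor x y ∈ Set.Icc 1 21 ∧
    ∀ a b : ℤ, 0 ≤ a → (a ≠ 0 ∨ b ≠ 0) → a.natAbs + b.natAbs ≤ tileColor x y →
      tileColor (x + a) (y + b) ≠ tileColor x y := by
  have h := tileCheck_eq_true
  simp only [tileCheck, forceApply_eq, allBelow_eq_true, Bool.and_eq_true, Nat.ble_eq] at h
  obtain ⟨⟨h1, h2⟩, h3⟩ := h (x % 24).toNat (by omega) (y % 24).toNat (by omega)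
  have hxy : tileNat (x % 24).toNat (y % 24).toNat = tileColor x y := by
    rw [← tileColor_emod x y, tileColor_eq (by omega) (by omega)]
  rw [hxy] at h1 h2 h3
  refine ⟨⟨h1, h2⟩, fun a b ha hab hle => ?_⟩
  have := ne_of_ballCheck h3 (by omega) ha (by omega) hab hle
  rwa [← tileColor_eq (by omega) (by omega), ← tileColor_add_mul _ _ (x / 24) (y / 24 - 2),
    show ((x % 24).toNat : ℤ) + a + 24 * (x / 24) = x + a by omega,
    show (((y % 24).toNat + 48 : ℕ) : ℤ) + b + 24 * (y / 24 - 2) = y + b by omega] at this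

theorem isPlaneColoring_tileColor {p : ℕ} (hp : 21 ≤ p) : IsPlaneColoring p tileColor :=
  .of_nonneg (fun x y => Set.Icc_subset_Icc_right hp (tileColor_mem_Icc_and_ne x y).1)
    fun x y => (tileColor_mem_Icc_and_ne x y).2

theorem isPlaneColoring_seam {T w b : ℕ} (hb : b ≤ 24) (h : seamCheck T w b = true) :
    IsPlaneColoring 47 (seam T w b) := by
  have htile := isPlaneColoring_tileColor (p := 47) (by norm_num)
  have hl (x y : ℤ) (hx : x < 47) : seam T w b x y = tileColor x y := if_pos hx
  have hr (x y : ℤ) (hx : (47 + w : ℕ) ≤ x) :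
      seam T w b x y = tileColor (x - (47 + w : ℕ)) (y - b) := by
    rw [seam, if_neg (by omega), if_neg (by omega)]
  simp only [seamCheck, forceApply_eq, allBelow_eq_true, Bool.and_eq_true, Nat.ble_eq] at h
  have key (x y : ℤ) (hx : 26 ≤ x) (hxw : x < 47 + w) : seam T w b x y ∈ Set.Icc 1 47 ∧
      ∀ a b' : ℤ, 0 ≤ a → (a ≠ 0 ∨ b' ≠ 0) → a.natAbs + b'.natAbs ≤ seam T w b x y →
        seam T w b (x + a) (y + b') ≠ seam T w b x y := by
    obtain ⟨⟨h1, h2⟩, h3⟩ := h (x - 26).toNat (by omega) (y % 48).toNat (by omega)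
    have hxy : seamNat T w b ((x - 26).toNat + 26) (y % 48).toNat = seam T w b x y := by
      rw [show (x - 26).toNat + 26 = x.toNat by omega, ← seam_eq hb (by omega) (by omega),
        ← seam_add_mul _ _ (y / 48), Int.emod_add_mul_ediv]
    rw [hxy] at h1 h2 h3
    refine ⟨⟨h1, h2⟩, fun a b' ha hab hle => ?_⟩
    by_cases hal : seam T w b x y ≤ 21 ∨ x + a < 47 + w
    · have := ne_of_ballCheck h3 (by omega) ha ?_ hab hle
      · rwa [← seam_eq hb (by omega) (by omega), ← seam_add_mul _ _ (y / 48 - 1),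
          show (((x - 26).toNat + 26 : ℕ) : ℤ) + a = x + a by omega,
          show (((y % 48).toNat + 48 : ℕ) : ℤ) + b' + 48 * (y / 48 - 1) = y + b' by omega] at this
      · simp only [cond_eq_ite, Nat.ble_eq]
        split_ifs <;> omega
    · rw [hr _ _ (by omega)]
      have := (tileColor_mem_Icc_and_ne (x + a - (47 + w : ℕ)) (y + b' - b)).1.2
      omega
  refine .of_nonneg (fun x y => ?_) fun x y a b' ha hab hle => ?_
  · by_cases hx : x < 47
    · rw [hl x y hx]
      exact htile.mem_Icc x y
    · by_cases hxw : x < 47 + w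
      · exact (key x y (by omega) hxw).1
      · rw [hr x y (by omega)]
        exact htile.mem_Icc _ _
  · by_cases hxw : x < 47 + w
    · by_cases hx : 26 ≤ x
      · exact (key x y hx hxw).2 a b' ha hab hle
      · have := (tileColor_mem_Icc_and_ne x y).1.2
        rw [hl x y (by omega)] at hle ⊢
        rw [hl _ _ (by omega)]
        exact htile.ne_of_le x y a b' hab hle
    · rw [hr x y (by omega)] at hle ⊢
      rw [hr _ _ (by omega)]
      exact (htile.translate (47 + w : ℕ) b).ne_of_le x y a b' hab hle

theorem shifts_of_seamCheck {T w b : ℕ} (hb : b ≤ 24) (h : seamCheck T w b = true) :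
    Shifts tileColor 47 (47 + w : ℕ) b := by
  refine ⟨_, isPlaneColoring_seam hb h, fun x y hx => if_pos hx, fun x y hx => ?_⟩
  rw [seam, if_neg (by omega), if_neg (by omega)]

/-! ### Arithmetic of displacements -/

/-- Nonnegative combinations of the three shifts, modulo the periods of `tileColor`. -/
theorem shifts_tileColor (i j l : ℕ) {a b : ℤ} (hle : (61 * i + 58 * j + 62 * l : ℕ) ≤ a)
    (ha : (24 : ℤ) ∣ a - (61 * i + 58 * j + 62 * l : ℕ))
    (hb : (24 : ℤ) ∣ b - (4 * i + 2 * j + 2 * l : ℕ)) : Shifts tileColor 47 a b := by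
  have hc := isPlaneColoring_tileColor (p := 47) (by norm_num)
  obtain ⟨m, hm⟩ := ha
  obtain ⟨n, hn⟩ := hb
  have h0 : Shifts tileColor 47 0 0 := ⟨_, hc, fun _ _ _ => rfl, fun _ _ _ => by simp⟩
  have ho := h0.nsmul (shifts_of_seamCheck (by norm_num) seamCheck_oddTable) (by norm_num) i
  have he := h0.nsmul (shifts_of_seamCheck (by norm_num) seamCheck_evenTable) (by norm_num) j
  have he' := h0.nsmul (shifts_of_seamCheck (by norm_num) seamCheck_evenTable') (by norm_num) l
  have hp : Shifts tileColor 47 (24 * m) (24 * n) := by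
    refine ⟨_, hc, fun _ _ _ => rfl, fun x y _ => ?_⟩
    rw [← tileColor_add_mul (x - _) _ m n, sub_add_cancel, sub_add_cancel]
  have := ((ho.add he (by positivity) (by positivity)).add he' (by positivity) (by positivity)).add hp
    (by positivity) (by omega)
  convert this using 1
  · push_cast at hm ⊢
    linarith
  · push_cast at hn ⊢
    linarith

/-- Every shift `(t, b)` with `t` odd and `b` even is, modulo `24`, a combination of the three
available ones of width less than `947`. -/
theorem exists_shift_combination (s q : ℕ) (hs : s < 12) (hq : q < 12) :
    ∃ i < 8, ∃ j < 9, ∃ l < 6, 61 * i + 58 * j + 62 * l ≤ 923 + 2 * s ∧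
      (923 + 2 * s - (61 * i + 58 * j + 62 * l)) % 24 = 0 ∧
      (4 * i + 2 * j + 2 * l) % 24 = 2 * q := by
  have : ∀ s < 12, ∀ q < 12,
    ∃ i < 8, ∃ j < 9, ∃ l < 6, 61 * i + 58 * j + 62 * l ≤ 923 + 2 * s ∧
      (923 + 2 * s - (61 * i + 58 * j + 62 * l)) % 24 = 0 ∧
      (4 * i + 2 * j + 2 * l) % 24 = 2 * q := by
    decide +kernel
  exact this s hs q hq

theorem theorem3 (k t : ℕ) (hk : 0 < k) (hk_even : Even k) (ht : 923 ≤ t) (ht_odd : Odd t)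
    (hkt : Nat.Coprime k t) :
    (distanceGraph {k, t}).packingChromaticNumber ≤ 56 := by
  -- The chosen `s` satisfies `923 + 2 s ≤ t` and `923 + 2 s ≡ t` modulo 24; the surplus is filled
  -- by horizontal periods of the tile.
  obtain ⟨i, -, j, -, l, -, h1, h2, h3⟩ := exists_shift_combination
    ((t - 923) % 24 / 2) ((-(k : ℤ)) % 24 / 2).toNat (by omega) (by omega)
  rw [Nat.even_iff] at hk_even
  rw [Nat.odd_iff] at ht_odd
  have hshift : Shifts tileColor 47 t (-k) :=
    shifts_tileColor i j l (by omega) (by omega) (by omega)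
  obtain ⟨f, hf, hper⟩ := hshift.exists_periodic (by omega) (by omega)
  calc _ ≤ ((47 : ℕ) : ℕ∞) := iInf₂_le 47 (hf.isPackingColoring hper (by omega) hkt)
    _ ≤ 56 := by norm_num
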